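/- Let $K$ be a finite set of diameter $1$ in a normed plane (a two-dimensional real normed space). Write $B(x,1)$ and $S(x,1)$ for the closed ball and the sphere with center $x$ and radius $1$, and let the ball hull $\operatorname{bh}(K)$ be the intersection of all balls of radius $\operatorname{diam}(K)=1$ that contain $K$. For two distinct points $p,q\in S(x,1)$, a minimal circular arc of $S(x,1)$ meeting $p$ and $q$ is an arc $\gamma\subseteq S(x,1)$ with endpoints $p$ and $q$ that lies in the closed half-plane which is bounded by the line through $p$ and $q$ and does not contain $x$; if $x$ lies on this line (so that $p$ and $q$ are opposite points), both half-circles with endpoints $p$ and $q$ are minimal circular arcs. Then there are finitely many points $x_1,\dots,x_k$ such that $$\operatorname{bh}(K)=\bigcap_{i=1}^{k} B(x_i,1),$$ and, for every $i$, the ball $B(x_i,1)$ contains $K$ and the sphere $S(x_i,1)$ contains a minimal circular arc meeting two distinct points of $K$. -/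

import Mathlib

/-- The `r`-ball hull of `K`: the intersection of all balls of radius `r` that contain `K`. -/
def ballHullRadius {E : Type*} [NormedAddCommGroup E] (K : Set E) (r : ℝ) : Set E :=
  ⋂ (x : E) (_ : K ⊆ Metric.closedBall x r), Metric.closedBall x r

/-- The ball hull `bh(K)`: the `r`-ball hull for `r = diam K`. -/
noncomputable def ballHull {E : Type*} [NormedAddCommGroup E] (K : Set E) : Set E :=
  ballHullRadius K (Metric.diam K)

/-- `γ` is an arc with endpoints `p` and `q`: the range of an injective path from `p` to `q`. -/
def IsArcBetween {E : Type*} [TopologicalSpace E] (γ : Set E) (p q : E) : Prop :=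
  ∃ g : Path p q, Function.Injective g ∧ Set.range g = γ

/-- `γ` is a minimal circular arc of the ball with center `x` and radius `r` meeting the two
points `p ≠ q`: a piece of the sphere with endpoints `p` and `q` which lies in a closed half-plane
bounded by the line through `p` and `q`, on the side of that line opposite to the center `x`.
If `x` lies on the line (`p` and `q` are opposite points of the sphere), the side condition is
void, and both half-circles with endpoints `p` and `q` are minimal circular arcs. -/
def IsMinimalArc {E : Type*} [NormedAddCommGroup E] [NormedSpace ℝ E]
    (γ : Set E) (x : E) (r : ℝ) (p q : E) : Prop :=
  p ≠ q ∧ γ ⊆ Metric.sphere x r ∧ IsArcBetween γ p q ∧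
    ∀ y ∈ γ, (AffineSubspace.WOppSide (line[ℝ, p, q]) x y)

open Metric Set

section Plane

variable {E : Type*} [NormedAddCommGroup E] [NormedSpace ℝ E]

/-! Call a center a vertex if its unit ball contains K and its sphere meets K in two distinct
points. Any two such points are joined by a minimal arc (`exists_isMinimalArc`), so it remains to
cut out bh(K) by finitely many vertex balls.

All vertex balls together suffice: if some ball containing K misses y, so does a vertex ball
(`exists_ballVertex_far`). Some center farthest from y lies on S(k,1) for a k in K. The part of
S(k,1) outside B(y,1) is connected and leaves the open ball around another point of K, so sliding
the center along it reaches a vertex.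

There may be infinitely many vertices, since spheres can share segments. But y lies in B(v,1) iff v
lies in the convex set B(y,1), so a finite set of vertices whose hull contains all of them is enough
(`exists_finite_ballVertices_subset_convexHull`). -/

/-- A nonzero functional on a plane that vanishes at `d ≠ 0` has kernel `ℝ d`. -/
theorem exists_functional_ker_eq_line (hE : Module.finrank ℝ E = 2) {d : E} (hd : d ≠ 0) :
    ∃ φ : E →L[ℝ] ℝ, φ ≠ 0 ∧ φ d = 0 ∧ ∀ z, φ z = 0 → ∃ t : ℝ, z = t • d := by
  have : FiniteDimensional ℝ E := Module.finite_of_finrank_pos (by omega)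
  have h1 : Module.finrank ℝ (ℝ ∙ d) = 1 := finrank_span_singleton hd
  have hlt : (ℝ ∙ d) < ⊤ := by
    refine lt_top_iff_ne_top.2 fun h => ?_
    rw [h, finrank_top] at h1
    omega
  obtain ⟨f, hf0, hf⟩ := Submodule.exists_le_ker_of_lt_top _ hlt
  have hker : (ℝ ∙ d) = LinearMap.ker f := by
    refine Submodule.eq_of_le_of_finrank_le hf ?_
    have hr := LinearMap.finrank_range_add_finrank_ker f
    have : 0 < Module.finrank ℝ (LinearMap.range f) := by
      rw [Nat.pos_iff_ne_zero]
      intro h0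
      exact hf0 (LinearMap.range_eq_bot.1 (Submodule.finrank_eq_zero.1 h0))
    omega
  refine ⟨LinearMap.toContinuousLinearMap f, ?_, ?_, ?_⟩
  · intro h
    apply hf0
    ext z
    exact congrArg (fun g : E →L[ℝ] ℝ => g z) h
  · exact hf (Submodule.mem_span_singleton_self d)
  · intro z hz
    have : z ∈ (ℝ ∙ d) := by
      rw [hker]
      exact hz
    obtain ⟨t, ht⟩ := Submodule.mem_span_singleton.1 this
    exact ⟨t, ht.symm⟩

/-! ### Minimal arcs as radial projections -/

/-- A curve `t ↦ α t • a + β t • c` of pairwise different directions, projected radially to the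
sphere around `x`, gives an arc. -/
theorem isArcBetween_radial {a c x p q : E} (hac : LinearIndependent ℝ ![a, c])
    {α β : ℝ → ℝ} (hα : Continuous α) (hβ : Continuous β)
    (hne : ∀ t ∈ Icc (0 : ℝ) 1, α t ≠ 0 ∨ β t ≠ 0)
    (hinj : ∀ s ∈ Icc (0 : ℝ) 1, ∀ t ∈ Icc (0 : ℝ) 1, ∀ l m : ℝ, 0 < l → 0 < m →
      l * α s = m * α t → l * β s = m * β t → s = t)
    (hp : x + ‖α 0 • a + β 0 • c‖⁻¹ • (α 0 • a + β 0 • c) = p)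
    (hq : x + ‖α 1 • a + β 1 • c‖⁻¹ • (α 1 • a + β 1 • c) = q) :
    IsArcBetween ((fun t : ℝ => x + ‖α t • a + β t • c‖⁻¹ • (α t • a + β t • c)) '' Icc 0 1)
      p q := by
  rw [LinearIndependent.pair_iff] at hac
  have hu : ∀ t ∈ Icc (0 : ℝ) 1, 0 < ‖α t • a + β t • c‖ := by
    intro t ht
    rw [norm_pos_iff]
    intro h
    have := hac _ _ h
    rcases hne t ht with h' | h'
    · exact h' this.1
    · exact h' this.2
  have hcont : ContinuousOn
      (fun t : ℝ => x + ‖α t • a + β t • c‖⁻¹ • (α t • a + β t • c)) (Icc 0 1) := by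
    have h : Continuous fun t : ℝ => α t • a + β t • c := by fun_prop
    exact continuousOn_const.add
      ((h.norm.continuousOn.inv₀ fun t ht => (hu t ht).ne').smul h.continuousOn)
  refine ⟨⟨⟨fun t => x + ‖α t • a + β t • c‖⁻¹ • (α t • a + β t • c),
    continuousOn_iff_continuous_domRestrict.1 hcont⟩, by simpa using hp, by simpa using hq⟩, ?_, ?_⟩
  · intro s t hst
    have hst' := add_left_cancel (show x + ‖α s • a + β s • c‖⁻¹ • (α s • a + β s • c) =
      x + ‖α t • a + β t • c‖⁻¹ • (α t • a + β t • c) from hst)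
    have h0 := hac (‖α s • a + β s • c‖⁻¹ * α s - ‖α t • a + β t • c‖⁻¹ * α t)
      (‖α s • a + β s • c‖⁻¹ * β s - ‖α t • a + β t • c‖⁻¹ * β t) (by
        rw [← sub_eq_zero] at hst'
        rw [← hst']
        module)
    exact Subtype.ext (hinj s s.2 t t.2 _ _ (inv_pos.2 (hu s s.2)) (inv_pos.2 (hu t t.2))
      (sub_eq_zero.1 h0.1) (sub_eq_zero.1 h0.2))
  · ext z
    constructor
    · rintro ⟨t, rfl⟩
      exact ⟨t, t.2, rfl⟩
    · rintro ⟨t, ht, rfl⟩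
      exact ⟨⟨t, ht⟩, rfl⟩

theorem norm_sub_radial {x u : E} (hu : u ≠ 0) : x + ‖u‖⁻¹ • u ∈ sphere x 1 := by
  rw [mem_sphere_iff_norm, add_sub_cancel_left, norm_smul, norm_inv, norm_norm]
  exact inv_mul_cancel₀ (norm_ne_zero_iff.2 hu)

/-- Two distinct points of a unit sphere of a normed plane are joined by a minimal arc. -/
theorem exists_isMinimalArc (hE : Module.finrank ℝ E = 2) {x p q : E} (hpq : p ≠ q)
    (hp : ‖p - x‖ = 1) (hq : ‖q - x‖ = 1) : ∃ γ : Set E, IsMinimalArc γ x 1 p q := by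
  have hp0 : p - x ≠ 0 := by
    intro h
    simp [h] at hp
  by_cases hli : LinearIndependent ℝ ![p - x, q - x]
  · have hli' := LinearIndependent.pair_iff.1 hli
    have hu : ∀ t : ℝ, (1 - t) • (p - x) + t • (q - x) ≠ 0 := by
      intro t h
      have := hli' _ _ h
      linarith [this.1, this.2]
    refine ⟨_, hpq, ?_, isArcBetween_radial (α := fun t => 1 - t) (β := fun t => t) (x := x) hli
      (by fun_prop) (by fun_prop) ?_ ?_ (by simp [hp]) (by simp [hq]), ?_⟩
    · rintro _ ⟨t, -, rfl⟩
      exact norm_sub_radial (hu t)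
    · intro t _
      by_contra! h
      linarith [h.1, h.2]
    · intro s _ t _ l m hl hm h1 h2
      have hlm : l = m := by linarith
      subst hlm
      exact mul_left_cancel₀ hl.ne' h2
    · rintro _ ⟨t, ht, rfl⟩
      set u := (1 - t) • (p - x) + t • (q - x) with hu_def
      have hmem : x + u ∈ line[ℝ, p, q] := by
        have : x + u = AffineMap.lineMap p q t := by
          rw [AffineMap.lineMap_apply, hu_def, vsub_eq_sub, vadd_eq_add]
          module
        rw [this]
        exact AffineMap.lineMap_mem_affineSpan_pair t p q
      have hle : ‖u‖ ≤ 1 := by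
        calc ‖u‖ ≤ ‖(1 - t) • (p - x)‖ + ‖t • (q - x)‖ := norm_add_le _ _
          _ = 1 := by
            rw [norm_smul, norm_smul, hp, hq, Real.norm_of_nonneg ht.1,
              Real.norm_of_nonneg (sub_nonneg.2 ht.2)]
            ring
      -- The chord lies in the ball, so projecting from `x` pushes its points outward, across the
      -- line.
      have h1 : 1 ≤ ‖u‖⁻¹ := (one_le_inv₀ (norm_pos_iff.2 (hu t))).2 hle
      refine ⟨x + u, hmem, x + u, hmem, ?_⟩
      have e1 : x -ᵥ (x + u) = -u := by
        rw [vsub_eq_sub]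
        abel
      have e2 : (x + u) -ᵥ (x + ‖u‖⁻¹ • u) = (‖u‖⁻¹ - 1) • (-u) := by
        rw [vsub_eq_sub]
        module
      simp only
      rw [← hu_def, e1, e2]
      exact SameRay.sameRay_nonneg_smul_right _ (sub_nonneg.2 h1)
  · have hqx : q - x = -(p - x) := by
      rw [LinearIndependent.pair_iff' hp0] at hli
      push Not at hli
      obtain ⟨r, hr⟩ := hli
      have hr1 : |r| = 1 := by
        have := congrArg norm hr
        rwa [norm_smul, hp, hq, mul_one, Real.norm_eq_abs] at this
      rcases eq_or_eq_neg_of_abs_eq hr1 with h | h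
      · rw [h, one_smul] at hr
        exact absurd (sub_left_injective hr) hpq
      · rw [← hr, h, neg_one_smul]
    obtain ⟨φ, hφ0, hφ, -⟩ := exists_functional_ker_eq_line hE hp0
    obtain ⟨c, hc⟩ : ∃ c, φ c ≠ 0 := by
      by_contra! h
      exact hφ0 (ContinuousLinearMap.ext h)
    have hli2 : LinearIndependent ℝ ![p - x, c] := by
      rw [LinearIndependent.pair_iff' hp0]
      rintro r rfl
      exact hc (by rw [map_smul, hφ, smul_zero])
    have hne : ∀ t : ℝ, 1 - 2 * t ≠ 0 ∨ t * (1 - t) ≠ 0 := by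
      intro t
      by_contra! h
      nlinarith [h.1, h.2]
    -- The chord of opposite points passes through `x`; a parabola bulging towards `c` replaces it.
    refine ⟨_, hpq, ?_, isArcBetween_radial (α := fun t => 1 - 2 * t) (β := fun t => t * (1 - t))
      (x := x) hli2 (by fun_prop) (by fun_prop) (fun t _ => hne t) ?_ (by simp [hp]) ?_, ?_⟩
    · rintro _ ⟨t, -, rfl⟩
      refine norm_sub_radial fun h => ?_
      have := LinearIndependent.pair_iff.1 hli2 _ _ h
      rcases hne t with h' | h'
      · exact h' this.1
      · exact h' this.2
    · intro s hs t ht l m hl hm h1 h2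
      have h3 : l * ((t - s) * ((1 - t) * (1 - s) + s * t)) = 0 := by
        linear_combination t * (1 - t) * h1 - (1 - 2 * t) * h2
      rcases mul_eq_zero.1 ((mul_eq_zero.1 h3).resolve_left hl.ne') with h4 | h4
      · linarith
      · have h5 : 0 ≤ (1 - t) * (1 - s) := mul_nonneg (by linarith [ht.2]) (by linarith [hs.2])
        have h6 : 0 ≤ s * t := mul_nonneg hs.1 ht.1
        have h7 : s * t = 0 := by linarith
        rcases mul_eq_zero.1 h7 with h | h <;> subst h <;> nlinarith
    · have : ((1 : ℝ) - 2 * 1) • (p - x) + ((1 : ℝ) * (1 - 1)) • c = q - x := by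
        rw [hqx]
        module
      rw [this, hq]
      simp
    · rintro y -
      refine AffineSubspace.wOppSide_of_left_mem y ?_
      have : x = AffineMap.lineMap p q (1 / 2 : ℝ) := by
        rw [AffineMap.lineMap_apply, vsub_eq_sub, vadd_eq_add,
          show q - p = (q - x) - (p - x) by abel, hqx]
        module
      rw [this]
      exact AffineMap.lineMap_mem_affineSpan_pair _ p q

/-! ### The unit sphere outside a translated ball -/

/-- Radially moving a unit vector `u` with `1 < ‖u + e‖` towards `e` keeps this inequality. -/
theorem norm_lt_norm_add_norm_smul {u e : E} (hu : ‖u‖ = 1) (hue : 1 < ‖u + e‖) {s : ℝ}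
    (hs : 0 ≤ s) (hv : u + s • e ≠ 0) : ‖u + s • e‖ < ‖u + s • e + ‖u + s • e‖ • e‖ := by
  obtain ⟨v, hvdef⟩ : ∃ v, v = u + s • e := ⟨_, rfl⟩
  rw [← hvdef] at hv ⊢
  obtain ⟨N, hN⟩ : ∃ N, N = ‖v‖ := ⟨_, rfl⟩
  have hN0 : 0 < N := hN ▸ norm_pos_iff.2 hv
  rw [← hN]
  by_contra! h
  have comb : ∀ (a b : ℝ) (y z : E), ‖a • y + b • z‖ ≤ |a| * ‖y‖ + |b| * ‖z‖ := by
    intro a b y z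
    simpa [norm_smul] using norm_add_le (a • y) (b • z)
  have hN1 : N ≤ 1 := by
    have h1 := comb N s u (v + N • e)
    have e1 : N • u + s • (v + N • e) = (s + N) • v := by
      rw [hvdef]
      module
    rw [e1, norm_smul, Real.norm_of_nonneg (by positivity), ← hN, hu, abs_of_pos hN0,
      abs_of_nonneg hs] at h1
    nlinarith [mul_le_mul_of_nonneg_left h hs]
  -- `hR` and `hL` put a segment spanning exactly one `e` into the unit ball, on the line through
  -- `u` and `v`. If `u` is at or before its left end, then `u + e` does not pass its right end and
  -- stays in the ball; otherwise `u` lies between the left end and `v`, where `N < 1` forces `‖u‖ <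
  -- 1`.
  have hR : ‖v + ((1 + N) / 2) • e‖ ≤ 1 := by
    have h1 := comb (1 + N) (-(1 - N)) (v + N • e) v
    have e1 : (1 + N) • (v + N • e) + (-(1 - N)) • v = (2 * N) • (v + ((1 + N) / 2) • e) := by
      module
    rw [e1, norm_smul, Real.norm_of_nonneg (by positivity), ← hN, abs_of_pos (by linarith),
      abs_neg, abs_of_nonneg (by linarith)] at h1
    nlinarith [mul_le_mul_of_nonneg_left h (by linarith : 0 ≤ 1 + N)]
  have hL : ‖v - ((1 - N) / 2) • e‖ ≤ 1 := by
    have h1 := comb (1 + N) (-(1 - N)) v (v + N • e)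
    have e1 : (1 + N) • v + (-(1 - N)) • (v + N • e) = (2 * N) • (v - ((1 - N) / 2) • e) := by
      module
    rw [e1, norm_smul, Real.norm_of_nonneg (by positivity), ← hN, abs_of_pos (by linarith),
      abs_neg, abs_of_nonneg (by linarith)] at h1
    nlinarith [mul_le_mul_of_nonneg_left h (by linarith : 0 ≤ 1 - N)]
  rcases le_or_gt ((1 - N) / 2) s with hc | hc
  · have h1 := comb (s + (1 + N) / 2 - 1) 1 u (v + ((1 + N) / 2) • e)
    have e1 : (s + (1 + N) / 2 - 1) • u + (1 : ℝ) • (v + ((1 + N) / 2) • e)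
        = (s + (1 + N) / 2) • (u + e) := by
      rw [hvdef]
      module
    rw [e1, norm_smul, Real.norm_of_nonneg (by positivity), hu, abs_of_nonneg (by linarith),
      abs_one] at h1
    nlinarith
  · have h1 := comb ((1 - N) / 2 - s) s v (v - ((1 - N) / 2) • e)
    have e1 : ((1 - N) / 2 - s) • v + s • (v - ((1 - N) / 2) • e) = ((1 - N) / 2) • u := by
      rw [hvdef]
      module
    rw [e1, norm_smul, Real.norm_of_nonneg (by linarith), hu, abs_of_nonneg (by linarith),
      abs_of_nonneg hs, ← hN] at h1
    nlinarith

/-- The part of the unit sphere outside of a translate of the unit ball is connected. -/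
theorem isPreconnected_sphere_diff_ball (hE : Module.finrank ℝ E = 2) {e : E} (he : e ≠ 0) :
    IsPreconnected {u : E | ‖u‖ = 1 ∧ 1 < ‖u + e‖} := by
  have he' : 0 < ‖e‖ := norm_pos_iff.2 he
  rcases lt_or_ge 2 ‖e‖ with h2 | h2
  · have : {u : E | ‖u‖ = 1 ∧ 1 < ‖u + e‖} = sphere 0 1 := by
      ext u
      simp only [mem_ofPred_eq, mem_sphere_zero_iff_norm, and_iff_left_iff_imp]
      intro hu
      have := norm_sub_le (u + e) u
      rw [add_sub_cancel_left] at this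
      linarith
    rw [this]
    refine isPreconnected_sphere ?_ _ _
    exact Module.lt_rank_of_lt_finrank (by rw [hE]; norm_num)
  -- Each `u` is joined to the direction of `e` by projecting the segment from `u` to `e`; `‖e‖ ≤ 2`
  -- keeps this segment away from 0.
  refine isPreconnected_of_forall (‖e‖⁻¹ • e) fun u ⟨hu, hue⟩ => ?_
  have hz : ∀ t ∈ Icc (0 : ℝ) 1, (1 - t) • u + t • e ≠ 0 ∧
      ‖(1 - t) • u + t • e‖ <
        ‖(1 - t) • u + t • e + ‖(1 - t) • u + t • e‖ • e‖ := by
    intro t ht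
    rcases ht.2.eq_or_lt with rfl | ht1
    · simp only [sub_self, zero_smul, one_smul, zero_add]
      refine ⟨he, ?_⟩
      have : e + ‖e‖ • e = (1 + ‖e‖) • e := by module
      rw [this, norm_smul, Real.norm_of_nonneg (by positivity)]
      nlinarith
    · have h1t : 0 < 1 - t := sub_pos.2 ht1
      have hs : 0 ≤ t / (1 - t) := div_nonneg ht.1 h1t.le
      have hzv : (1 - t) • u + t • e = (1 - t) • (u + (t / (1 - t)) • e) := by
        rw [smul_add, smul_smul, mul_div_cancel₀ _ h1t.ne']
      have hv : u + (t / (1 - t)) • e ≠ 0 := by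
        intro h0
        have hu' : u = -(t / (1 - t)) • e := by
          rw [neg_smul]
          exact eq_neg_of_add_eq_zero_left h0
        generalize t / (1 - t) = s at hs hu'
        have h3 : s * ‖e‖ = 1 := by
          rw [hu', norm_smul, norm_neg, Real.norm_of_nonneg hs] at hu
          exact hu
        have h4 : u + e = (1 - s) • e := by
          rw [hu']
          module
        rw [h4, norm_smul, Real.norm_eq_abs] at hue
        rcases abs_cases (1 - s) with ⟨h, _⟩ | ⟨h, _⟩ <;> rw [h] at hue <;> nlinarith
      have := norm_lt_norm_add_norm_smul hu hue hs hv
      rw [hzv]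
      refine ⟨smul_ne_zero h1t.ne' hv, ?_⟩
      rw [norm_smul, Real.norm_of_nonneg h1t.le, mul_smul, ← smul_add, norm_smul,
        Real.norm_of_nonneg h1t.le]
      exact mul_lt_mul_of_pos_left this h1t
  refine ⟨(fun t : ℝ => ‖(1 - t) • u + t • e‖⁻¹ • ((1 - t) • u + t • e)) '' Icc 0 1, ?_,
    ⟨1, by simp⟩, ⟨0, by simp [hu]⟩, isPreconnected_Icc.image _ ?_⟩
  · rintro _ ⟨t, ht, rfl⟩
    obtain ⟨h0, h1⟩ := hz t ht
    simp only
    generalize (1 - t) • u + t • e = z at h0 h1 ⊢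
    have hz0 : 0 < ‖z‖ := norm_pos_iff.2 h0
    constructor
    · rw [norm_smul, norm_inv, norm_norm, inv_mul_cancel₀ hz0.ne']
    · have : ‖z‖⁻¹ • z + e = ‖z‖⁻¹ • (z + ‖z‖ • e) := by
        rw [smul_add, smul_smul, inv_mul_cancel₀ hz0.ne', one_smul]
      rw [this, norm_smul, norm_inv, norm_norm, inv_mul_eq_div, one_lt_div hz0]
      exact h1
  · have h : Continuous fun t : ℝ => (1 - t) • u + t • e := by fun_prop
    exact (h.norm.continuousOn.inv₀ fun t ht => norm_ne_zero_iff.2 (hz t ht).1).smul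
      h.continuousOn

/-- Take a supporting line of the unit ball parallel to `d`, on the side towards which `e` points,
and let `w` be the last point of the ball on a ray in direction `e` from a contact point. -/
theorem exists_norm_eq_one_lt_norm_add (hE : Module.finrank ℝ E = 2) {d e : E} (hd : d ≠ 0)
    (he : e ≠ 0) : ∃ w : E, ‖w‖ = 1 ∧ 1 < ‖w + e‖ ∧ 1 ≤ ‖w - d‖ := by
  have : FiniteDimensional ℝ E := Module.finite_of_finrank_pos (by omega)
  have : ProperSpace E := FiniteDimensional.proper_real E
  obtain ⟨φ, hφ0, hφd, hφe⟩ : ∃ φ : E →L[ℝ] ℝ, φ ≠ 0 ∧ φ d = 0 ∧ 0 ≤ φ e := by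
    obtain ⟨φ, h0, h1, -⟩ := exists_functional_ker_eq_line hE hd
    rcases le_total 0 (φ e) with h | h
    · exact ⟨φ, h0, h1, h⟩
    · exact ⟨-φ, neg_ne_zero.2 h0, by simp [h1], by simpa using h⟩
  obtain ⟨w₀, hw₀, hmax⟩ := (isCompact_closedBall (0 : E) 1).exists_isMaxOn
    ⟨0, by simp⟩ φ.continuous.continuousOn
  have hle : ∀ z, φ z ≤ φ w₀ * ‖z‖ := by
    intro z
    rcases eq_or_ne z 0 with rfl | hz
    · simp
    have hz' : 0 < ‖z‖ := norm_pos_iff.2 hz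
    have h1 : φ (‖z‖⁻¹ • z) ≤ φ w₀ := hmax (by
      rw [mem_closedBall_zero_iff, norm_smul, norm_inv, norm_norm, inv_mul_cancel₀ hz'.ne'])
    rw [map_smul, smul_eq_mul, inv_mul_le_iff₀ hz'] at h1
    linarith
  have hpos : 0 < φ w₀ := by
    by_contra! hneg
    apply hφ0
    ext z
    have h1 := hle z
    have h2 := hle (-z)
    rw [map_neg, norm_neg] at h2
    have h3 := mul_nonneg (neg_nonneg.2 hneg) (norm_nonneg z)
    simp only [zero_apply]
    linarith
  have hge : ∀ z, φ w₀ ≤ φ z → 1 ≤ ‖z‖ := by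
    intro z hz
    have := hle z
    by_contra! h
    nlinarith
  have hcpt : IsCompact {t : ℝ | 0 ≤ t ∧ ‖w₀ + t • e‖ ≤ 1} := by
    refine (isCompact_Icc (a := (0 : ℝ)) (b := 2 / ‖e‖)).of_isClosed_subset ?_ ?_
    · exact (isClosed_le continuous_const continuous_id).inter
        (isClosed_le (f := fun t : ℝ => ‖w₀ + t • e‖) (by fun_prop) continuous_const)
    · rintro t ⟨ht0, ht⟩
      refine ⟨ht0, ?_⟩
      rw [le_div_iff₀ (norm_pos_iff.2 he)]
      have h1 := norm_sub_le (w₀ + t • e) w₀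
      rw [add_sub_cancel_left, norm_smul, Real.norm_of_nonneg ht0] at h1
      have h2 := mem_closedBall_zero_iff.1 hw₀
      linarith
  obtain ⟨t, ⟨ht0, ht⟩, htmax⟩ := hcpt.exists_isMaxOn
    ⟨0, le_rfl, by simpa using hw₀⟩ continuous_id.continuousOn
  have hφw : φ w₀ ≤ φ (w₀ + t • e) := by
    rw [map_add, map_smul, smul_eq_mul]
    nlinarith
  refine ⟨w₀ + t • e, le_antisymm ht (hge _ hφw), ?_, hge _ (by rwa [map_sub, hφd, sub_zero])⟩
  by_contra! h
  have h1 : t + 1 ≤ t := htmax (a := t + 1) ⟨by linarith, by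
    rwa [add_smul, one_smul, ← add_assoc]⟩
  linarith

/-! ### Vertex balls determine the ball hull -/

/-- The points `x` whose unit ball contains `K` and has two distinct points of `K` on its sphere. -/
def ballVertices (K : Set E) : Set E :=
  {x | (∀ k ∈ K, ‖x - k‖ ≤ 1) ∧ ∃ p ∈ K, ∃ q ∈ K, p ≠ q ∧ ‖x - p‖ = 1 ∧ ‖x - q‖ = 1}

theorem exists_ballVertex_far_of_mem_sphere (hE : Module.finrank ℝ E = 2) {K : Set E}
    (hK : K.Finite) {k d x y : E} (hk : k ∈ K) (hd : d ∈ K) (hdk : d ≠ k)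
    (hx : ∀ q ∈ K, ‖x - q‖ ≤ 1) (hxk : ‖x - k‖ = 1) (hxy : 1 < ‖x - y‖) :
    ∃ v ∈ ballVertices K, 1 < ‖v - y‖ := by
  by_contra! hV
  have he : k - y ≠ 0 := by
    intro h
    rw [← sub_eq_zero.1 h] at hxy
    linarith
  have hA := isPreconnected_sphere_diff_ball hE he
  obtain ⟨w, hw1, hwe, hwd⟩ := exists_norm_eq_one_lt_norm_add hE (sub_ne_zero.2 hdk) he
  -- Without a vertex far from `y`, no center on the connected piece passes from `U` to `W`; so the
  -- piece stays in `U`, which `w` contradicts.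
  let U : Set E := ⋂ q ∈ K \ {k}, {u | ‖u + k - q‖ < 1}
  let W : Set E := ⋃ q ∈ K \ {k}, {u | 1 < ‖u + k - q‖}
  have hUo : IsOpen U := (hK.subset sdiff_subset).isOpen_biInter fun q _ =>
    isOpen_lt (by fun_prop) continuous_const
  have hWo : IsOpen W := isOpen_biUnion fun q _ => isOpen_lt continuous_const (by fun_prop)
  have hmemU : ∀ u : E, ‖u‖ = 1 → 1 < ‖u + (k - y)‖ → (∀ q ∈ K, ‖u + k - q‖ ≤ 1) → u ∈ U := by
    intro u hu1 hue hu
    refine mem_iInter₂.2 fun q hq => lt_of_le_of_ne (hu q hq.1) fun hq1 => ?_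
    have := hV (u + k) ⟨hu, k, hk, q, hq.1, fun h => hq.2 h.symm, by simpa using hu1, hq1⟩
    rw [add_sub_assoc] at this
    linarith
  have hcov : {u : E | ‖u‖ = 1 ∧ 1 < ‖u + (k - y)‖} ⊆ U ∪ W := by
    rintro u ⟨hu1, hue⟩
    by_cases h : u ∈ W
    · exact Or.inr h
    · refine Or.inl (hmemU u hu1 hue fun q hq => ?_)
      by_contra! hlt
      refine h (mem_iUnion₂.2 ⟨q, ⟨hq, ?_⟩, hlt⟩)
      rintro rfl
      rw [add_sub_cancel_right] at hlt
      linarith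
  have hxA : x - k ∈ {u : E | ‖u‖ = 1 ∧ 1 < ‖u + (k - y)‖} := ⟨hxk, by simpa using hxy⟩
  have hxU : x - k ∈ U := hmemU _ hxk hxA.2 (by simpa using hx)
  have hdisj : Disjoint U W := by
    rw [Set.disjoint_left]
    intro u hu hu'
    obtain ⟨q, hq, hlt⟩ := mem_iUnion₂.1 hu'
    have hgt : ‖u + k - q‖ < 1 := mem_iInter₂.1 hu q hq
    exact lt_asymm hlt hgt
  have hAU := hA.subset_left_of_subset_union hUo hWo hdisj hcov ⟨_, hxA, hxU⟩
  have hwU : ‖w + k - d‖ < 1 := mem_iInter₂.1 (hAU ⟨hw1, hwe⟩) d ⟨hd, hdk⟩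
  rw [show w + k - d = w - (d - k) by abel] at hwU
  linarith

theorem exists_ballVertex_far (hE : Module.finrank ℝ E = 2) {K : Set E} (hK : K.Finite)
    (hnt : K.Nontrivial) {x y : E} (hx : ∀ q ∈ K, ‖x - q‖ ≤ 1) (hxy : 1 < ‖x - y‖) :
    ∃ v ∈ ballVertices K, 1 < ‖v - y‖ := by
  have : FiniteDimensional ℝ E := Module.finite_of_finrank_pos (by omega)
  have : ProperSpace E := FiniteDimensional.proper_real E
  have hcpt : IsCompact (⋂ q ∈ K, closedBall q 1) := by
    obtain ⟨q, hq⟩ := hnt.nonempty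
    exact (isCompact_closedBall q 1).of_isClosed_subset
      (isClosed_biInter fun _ _ => isClosed_closedBall) (biInter_subset_of_mem hq)
  have hmem : ∀ z : E, z ∈ (⋂ q ∈ K, closedBall q 1) ↔ ∀ q ∈ K, ‖z - q‖ ≤ 1 := by
    intro z
    simp [dist_eq_norm]
  obtain ⟨z, hz, hmax⟩ := hcpt.exists_isMaxOn ⟨x, (hmem x).2 hx⟩
    (f := fun z => ‖z - y‖) (by fun_prop)
  have hzy : 1 < ‖z - y‖ := hxy.trans_le (hmax ((hmem x).2 hx))
  rw [hmem] at hz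
  by_cases hsph : ∃ k ∈ K, ‖z - k‖ = 1
  · obtain ⟨k, hk, hzk⟩ := hsph
    obtain ⟨d, hd, hdk⟩ := hnt.exists_ne k
    exact exists_ballVertex_far_of_mem_sphere hE hK hk hd hdk hz hzk hzy
  -- A farthest center in the interior of all the balls could still move away from `y`.
  · push Not at hsph
    exfalso
    have hopen : IsOpen (⋂ q ∈ K, {t : ℝ | ‖z + t • (z - y) - q‖ < 1}) :=
      hK.isOpen_biInter fun q _ => isOpen_lt (by fun_prop) continuous_const
    have h0 : (0 : ℝ) ∈ ⋂ q ∈ K, {t : ℝ | ‖z + t • (z - y) - q‖ < 1} := by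
      refine mem_iInter₂.2 fun q hq => ?_
      simpa using lt_of_le_of_ne (hz q hq) (hsph q hq)
    obtain ⟨ε, hε, hball⟩ := Metric.isOpen_iff.1 hopen 0 h0
    have hmem' : ε / 2 ∈ ⋂ q ∈ K, {t : ℝ | ‖z + t • (z - y) - q‖ < 1} := hball (by
      rw [mem_ball_zero_iff, Real.norm_of_nonneg (by positivity)]
      linarith)
    have h1 : ‖z + (ε / 2) • (z - y) - y‖ ≤ ‖z - y‖ := hmax ((hmem _).2 fun q hq =>
      (mem_iInter₂.1 hmem' q hq).le)
    have h2 : z + (ε / 2) • (z - y) - y = (1 + ε / 2) • (z - y) := by module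
    rw [h2, norm_smul, Real.norm_of_nonneg (by positivity)] at h1
    nlinarith

/-! ### Finitely many vertices suffice -/

/-- Two unit spheres with centers at a distance less than `2` meet in points that have the same
distance from the line through the centers. -/
theorem abs_functional_le_of_mem_spheres {d u₁ u₂ : E} (hd2 : ‖d‖ < 2)
    {φ : E →L[ℝ] ℝ} (hφd : φ d = 0) (hφ : ∀ z, φ z = 0 → ∃ t : ℝ, z = t • d)
    (h₁ : ‖u₁‖ = 1) (h₁' : ‖u₁ - d‖ = 1) (h₂ : ‖u₂‖ = 1) (h₂' : ‖u₂ - d‖ = 1) :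
    |φ u₁| ≤ |φ u₂| := by
  -- The reflection `u ↦ d - u` swaps the two spheres and negates `φ`.
  wlog hs₁ : 0 ≤ φ u₁ generalizing u₁
  · have := this (u₁ := d - u₁) (by rwa [norm_sub_rev]) (by simpa using h₁)
      (by rw [map_sub, hφd]; linarith)
    rwa [map_sub, hφd, zero_sub, abs_neg] at this
  wlog hs₂ : 0 ≤ φ u₂ generalizing u₂
  · have := this (u₂ := d - u₂) (by rwa [norm_sub_rev]) (by simpa using h₂)
      (by rw [map_sub, hφd]; linarith)
    rwa [map_sub, hφd, zero_sub, abs_neg] at this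
  rw [abs_of_nonneg hs₁, abs_of_nonneg hs₂]
  by_contra! hlt
  have hpos : 0 < φ u₁ := hs₂.trans_lt hlt
  obtain ⟨a, ha⟩ : ∃ a, a = φ u₂ / φ u₁ := ⟨_, rfl⟩
  have ha0 : 0 ≤ a := ha ▸ div_nonneg hs₂ hs₁
  have ha1 : a < 1 := ha ▸ (div_lt_one hpos).2 hlt
  have comb : ∀ (a b : ℝ) (y z : E), 0 ≤ a → 0 ≤ b → ‖a • y + b • z‖ ≤ a * ‖y‖ + b * ‖z‖ := by
    intro a b y z ha hb
    have := norm_add_le (a • y) (b • z)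
    rwa [norm_smul, norm_smul, Real.norm_of_nonneg ha, Real.norm_of_nonneg hb] at this
  -- This point between `u₁` and `d / 2` has the height of `u₂` and is interior to both balls, since
  -- `‖d‖ < 2`. Moving from it along `d` or `-d` cannot reach a common point of both spheres.
  have hw : ‖a • u₁ + ((1 - a) / 2) • d‖ < 1 := by
    have := comb a ((1 - a) / 2) u₁ d ha0 (by linarith)
    rw [h₁] at this
    nlinarith
  have hw' : ‖a • u₁ + ((1 - a) / 2) • d - d‖ < 1 := by
    have := comb a ((1 - a) / 2) (u₁ - d) (-d) ha0 (by linarith)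
    rw [h₁', norm_neg] at this
    have e : a • (u₁ - d) + ((1 - a) / 2) • (-d) = a • u₁ + ((1 - a) / 2) • d - d := by
      module
    rw [e] at this
    nlinarith
  obtain ⟨t, ht⟩ := hφ (u₂ - (a • u₁ + ((1 - a) / 2) • d)) (by
    rw [map_sub, map_add, map_smul, map_smul, hφd, ha, smul_eq_mul, div_mul_cancel₀ _ hpos.ne']
    simp)
  generalize a • u₁ + ((1 - a) / 2) • d = w at hw hw' ht
  have hu : u₂ = w + t • d := by rw [← ht]; abel
  rcases le_total 0 t with h | h
  · have := comb 1 t (w - d) u₂ zero_le_one h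
    rw [h₂, one_mul, show (1 : ℝ) • (w - d) + t • u₂ = (1 + t) • (u₂ - d) by
      rw [hu]; module, norm_smul, h₂', Real.norm_of_nonneg (by linarith)] at this
    linarith
  · have := comb 1 (-t) w (u₂ - d) zero_le_one (by linarith)
    rw [h₂', one_mul, show (1 : ℝ) • w + (-t) • (u₂ - d) = (1 + -t) • u₂ by
      rw [hu]; module, norm_smul, h₂, Real.norm_of_nonneg (by linarith)] at this
    linarith

/-- A compact set on a line lies in the convex hull of a finite subset. -/
theorem exists_finite_subset_convexHull_of_line {d : E} (hd : d ≠ 0) {T : Set E}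
    (hT : IsCompact T) (hline : ∀ a ∈ T, ∀ b ∈ T, ∃ t : ℝ, b - a = t • d) :
    ∃ F ⊆ T, F.Finite ∧ T ⊆ convexHull ℝ F := by
  rcases T.eq_empty_or_nonempty with rfl | hne
  · exact ⟨∅, subset_rfl, finite_empty, empty_subset _⟩
  obtain ⟨ψ, hψ⟩ := SeparatingDual.exists_eq_one (R := ℝ) hd
  obtain ⟨a, ha, hmin⟩ := hT.exists_isMinOn hne ψ.continuous.continuousOn
  obtain ⟨b, hb, hmax⟩ := hT.exists_isMaxOn hne ψ.continuous.continuousOn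
  refine ⟨{a, b}, insert_subset ha (singleton_subset_iff.2 hb), toFinite _, fun z hz => ?_⟩
  rw [convexHull_pair]
  obtain ⟨s, hs⟩ := hline a ha b hb
  obtain ⟨t, ht⟩ := hline a ha z hz
  have hs' : ψ b - ψ a = s := by rw [← map_sub, hs, map_smul, hψ, smul_eq_mul, mul_one]
  have ht' : ψ z - ψ a = t := by rw [← map_sub, ht, map_smul, hψ, smul_eq_mul, mul_one]
  have h1 : ψ a ≤ ψ z := hmin hz
  have h2 : ψ z ≤ ψ b := hmax hz
  have hz' : z = a + t • d := by rw [← ht]; abel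
  rcases (show 0 ≤ s by linarith).eq_or_lt with h0 | h0
  · have : t = 0 := by linarith
    rw [hz', this, zero_smul, add_zero]
    exact left_mem_segment ℝ a b
  · rw [segment_eq_image']
    refine ⟨t / s, ⟨div_nonneg (by linarith) h0.le, (div_le_one h0).2 (by linarith)⟩, ?_⟩
    simp only
    rw [hs, smul_smul, div_mul_cancel₀ _ h0.ne', hz']

/-- For each of the finitely many pairs in `K`, the vertices lie on at most two lines parallel to
the pair, and on each line they form a compact set, covered by the hull of its extreme points. -/
theorem exists_finite_ballVertices_subset_convexHull (hE : Module.finrank ℝ E = 2) {K : Set E}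
    (hK : K.Finite) (hdiam : ∀ p ∈ K, ∀ q ∈ K, ‖p - q‖ < 2) :
    ∃ F ⊆ ballVertices K, F.Finite ∧ ballVertices K ⊆ convexHull ℝ F := by
  have : FiniteDimensional ℝ E := Module.finite_of_finrank_pos (by omega)
  have : ProperSpace E := FiniteDimensional.proper_real E
  have key : ∀ r : E × E, ∃ F : Set E, r ∈ K ×ˢ K → r.1 ≠ r.2 → F ⊆ ballVertices K ∧ F.Finite ∧
      {x | (∀ k ∈ K, ‖x - k‖ ≤ 1) ∧ ‖x - r.1‖ = 1 ∧ ‖x - r.2‖ = 1} ⊆ convexHull ℝ F := by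
    rintro ⟨p, q⟩
    by_cases hpq : (p, q) ∈ K ×ˢ K ∧ p ≠ q
    swap
    · exact ⟨∅, fun h1 h2 => absurd ⟨h1, h2⟩ hpq⟩
    obtain ⟨⟨hp, hq⟩, hne⟩ := hpq
    simp only at hp hq ⊢
    have hd : q - p ≠ 0 := sub_ne_zero.2 hne.symm
    obtain ⟨φ, -, hφd, hφ⟩ := exists_functional_ker_eq_line hE hd
    let T : ℝ → Set E := fun c =>
      {x | (∀ k ∈ K, ‖x - k‖ ≤ 1) ∧ ‖x - p‖ = 1 ∧ ‖x - q‖ = 1 ∧ φ (x - p) = c}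
    have hTV : ∀ c, T c ⊆ ballVertices K := fun c x hx =>
      ⟨hx.1, p, hp, q, hq, hne, hx.2.1, hx.2.2.1⟩
    have hT : ∀ c, ∃ F ⊆ T c, F.Finite ∧ T c ⊆ convexHull ℝ F := by
      intro c
      refine exists_finite_subset_convexHull_of_line hd ?_ ?_
      · refine (isCompact_closedBall p 1).of_isClosed_subset ?_ ?_
        · have h1 : IsClosed {x : E | ∀ k ∈ K, ‖x - k‖ ≤ 1} := by
            simp only [ofPred_forall]
            exact isClosed_biInter fun k _ => isClosed_le (by fun_prop) continuous_const
          exact h1.inter ((isClosed_eq (by fun_prop) continuous_const).inter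
            ((isClosed_eq (by fun_prop) continuous_const).inter
              (isClosed_eq (by fun_prop) continuous_const)))
        · intro x hx
          exact mem_closedBall_iff_norm.2 hx.2.1.le
      · intro a ha b hb
        refine hφ _ ?_
        rw [show b - a = (b - p) - (a - p) by abel, map_sub, ha.2.2.2, hb.2.2.2, sub_self]
    rcases {x | (∀ k ∈ K, ‖x - k‖ ≤ 1) ∧ ‖x - p‖ = 1 ∧ ‖x - q‖ = 1}.eq_empty_or_nonempty with
      h0 | ⟨u, hu⟩
    · refine ⟨∅, fun _ _ => ⟨empty_subset _, finite_empty, ?_⟩⟩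
      rw [h0]
      exact empty_subset _
    obtain ⟨F₁, hF₁, hfin₁, hc₁⟩ := hT (φ (u - p))
    obtain ⟨F₂, hF₂, hfin₂, hc₂⟩ := hT (-φ (u - p))
    refine ⟨F₁ ∪ F₂, fun _ _ => ⟨union_subset (hF₁.trans (hTV _)) (hF₂.trans (hTV _)),
      hfin₁.union hfin₂, ?_⟩⟩
    rintro x ⟨hx, hxp, hxq⟩
    have hd2 := hdiam q hq p hp
    have hxq' : ‖x - p - (q - p)‖ = 1 := by rwa [sub_sub_sub_cancel_right]
    have huq' : ‖u - p - (q - p)‖ = 1 := by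
      rw [sub_sub_sub_cancel_right]
      exact hu.2.2
    have habs : |φ (x - p)| = |φ (u - p)| := le_antisymm
      (abs_functional_le_of_mem_spheres hd2 hφd hφ hxp hxq' hu.2.1 huq')
      (abs_functional_le_of_mem_spheres hd2 hφd hφ hu.2.1 huq' hxp hxq')
    rcases abs_eq_abs.1 habs with h | h
    · exact convexHull_mono subset_union_left (hc₁ ⟨hx, hxp, hxq, h⟩)
    · exact convexHull_mono subset_union_right (hc₂ ⟨hx, hxp, hxq, h⟩)
  choose F hF using key
  refine ⟨⋃ r ∈ {r ∈ K ×ˢ K | r.1 ≠ r.2}, F r, ?_, ?_, ?_⟩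
  · exact iUnion₂_subset fun r hr => (hF r hr.1 hr.2).1
  · exact ((hK.prod hK).subset (sep_subset _ _)).biUnion fun r hr => (hF r hr.1 hr.2).2.1
  · rintro x ⟨hx, p, hp, q, hq, hpq, hxp, hxq⟩
    have hr : (p, q) ∈ {r ∈ K ×ˢ K | r.1 ≠ r.2} := ⟨⟨hp, hq⟩, hpq⟩
    exact convexHull_mono (subset_biUnion_of_mem (u := F) hr)
      ((hF (p, q) hr.1 hr.2).2.2 ⟨hx, hxp, hxq⟩)

end Plane

theorem mainTheorem9 {E : Type*} [NormedAddCommGroup E] [NormedSpace ℝ E]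
    (hE : Module.finrank ℝ E = 2) (K : Set E) (hfin : K.Finite) (hdiam : Metric.diam K = 1) :
    ∃ (k : ℕ) (x : Fin k → E),
      ballHull K = ⋂ i, Metric.closedBall (x i) 1 ∧
      ∀ i, K ⊆ Metric.closedBall (x i) 1 ∧
        ∃ p ∈ K, ∃ q ∈ K, ∃ γ : Set E, IsMinimalArc γ (x i) 1 p q := by
  have hnt : K.Nontrivial := by
    by_contra h
    rw [Set.not_nontrivial_iff] at h
    rw [Metric.diam_subsingleton h] at hdiam
    exact zero_ne_one hdiam
  obtain ⟨F, hFV, hFfin, hFconv⟩ := exists_finite_ballVertices_subset_convexHull hE hfin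
    fun p hp q hq => by
      have := Metric.dist_le_diam_of_mem hfin.isBounded hp hq
      rw [hdiam, dist_eq_norm] at this
      linarith
  have hsub : ∀ v ∈ F, K ⊆ closedBall v 1 := fun v hv k hk => by
    rw [mem_closedBall_iff_norm, norm_sub_rev]
    exact (hFV hv).1 k hk
  obtain ⟨n, x, hx⟩ : ∃ (n : ℕ) (x : Fin n → E), range x = F := by
    have := hFfin.fintype
    refine ⟨Fintype.card F, fun i => (Fintype.equivFin F).symm i, ?_⟩
    ext v
    constructor
    · rintro ⟨i, rfl⟩
      exact Subtype.coe_prop _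
    · intro hv
      exact ⟨Fintype.equivFin F ⟨v, hv⟩, by simp⟩
  have hxF : ∀ i, x i ∈ F := fun i => hx ▸ mem_range_self i
  refine ⟨n, x, ?_, fun i => ⟨hsub _ (hxF i), ?_⟩⟩
  · rw [ballHull, ballHullRadius, hdiam]
    refine Subset.antisymm (subset_iInter fun i => iInter₂_subset (x i) (hsub _ (hxF i))) ?_
    intro y hy
    refine mem_iInter₂.2 fun c hc => ?_
    have hFy : F ⊆ closedBall y 1 := by
      rw [← hx]
      rintro _ ⟨i, rfl⟩
      exact mem_closedBall_comm.1 (mem_iInter.1 hy i)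
    -- Convexity of the ball around `y` passes from `F` to all vertices.
    have hVy := hFconv.trans (convexHull_min hFy (convex_closedBall y 1))
    rw [mem_closedBall_comm, mem_closedBall_iff_norm]
    by_contra! hcy
    obtain ⟨v, hv, hvy⟩ := exists_ballVertex_far hE hfin hnt
      (fun q hq => mem_closedBall_iff_norm'.1 (hc hq)) hcy
    exact hvy.not_ge (mem_closedBall_iff_norm.1 (hVy hv))
  · obtain ⟨-, p, hp, q, hq, hpq, hxp, hxq⟩ := hFV (hxF i)
    exact ⟨p, hp, q, hq, exists_isMinimalArc hE hpq (by rwa [norm_sub_rev])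
      (by rwa [norm_sub_rev])⟩
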